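/- Let $R$ be an integral domain of characteristic $0$ (for example $\mathbb{Z}$, $\mathbb{Q}$ or $\mathbb{C}$). For a partition $\lambda$, let $S_\lambda(x_1,\ldots,x_n)$ be the Schur function, and let the hook Schur function $HS_\lambda(x_1,\ldots,x_k;y_1,\ldots,y_\ell)$ be the sum of the monomials of all fillings of the Young diagram of $\lambda$ by the symbols $1<\cdots<k<1'<\cdots<\ell'$ that are weakly increasing in each row and in each column, with no unprimed symbol repeated in a column and no primed symbol repeated in a row; here a symbol $j$ contributes a factor $x_j$ and a symbol $j'$ a factor $y_j$. A symmetric function $\sum_\lambda m_\lambda S_\lambda$ (a finite sum, $m_\lambda\in R$) is called doubly symmetric if $$\sum_\lambda m_\lambda S_\lambda(x_1,\ldots,x_k,y_1,\ldots,y_\ell)=\sum_\lambda m_\lambda HS_\lambda(x_1,\ldots,x_k;y_1,\ldots,y_\ell)$$ for all $k,\ell\ge 0$, as polynomials over $R$ in the variables $x_1,\ldots,x_k,y_1,\ldots,y_\ell$. Theorem. Let $f=\sum_\lambda m_\lambda S_\lambda$ be a symmetric function with coefficients in $R$ such that for every $n\ge 0$ and every $0\le i\le n$ the polynomial $f(x_1,\ldots,x_n)$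 can be written as a finite linear combination $$f(x_1,\ldots,x_n)=\sum_\lambda c_\lambda\, HS_\lambda(x_1,\ldots,x_i;x_{i+1},\ldots,x_n),$$ where the coefficients $c_\lambda\in R$ may depend on $i$ and $n$. Then $f$ is doubly symmetric. -/

import Mathlib

/-- A filling `T` of the cells of `μ` (cell `(i, j)` is in row `i`, column `j`) by `1 < ⋯ < n`
(indexed by `Fin n`) is semistandard if its entries are weakly increasing along rows and
strictly increasing down columns. -/
structure IsSemistandard {μ : YoungDiagram} {n : ℕ} (T : μ.cells → Fin n) : Prop where
  row_le : ∀ c d : μ.cells, c.1.1 = d.1.1 → c.1.2 < d.1.2 → T c ≤ T d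
  col_lt : ∀ c d : μ.cells, c.1.2 = d.1.2 → c.1.1 < d.1.1 → T c < T d

/-- A filling of the cells of `μ` by the alphabet `1 < ⋯ < k < 1' < ⋯ < l'`, which is the ordered
sum `Fin k ⊕ₗ Fin l`, is `(k, l)`-semistandard if its entries are weakly increasing along rows
and down columns, no unprimed symbol is repeated in a column, and no primed symbol is repeated
in a row. -/
structure IsHookSemistandard {μ : YoungDiagram} {k l : ℕ} (T : μ.cells → Fin k ⊕ₗ Fin l) :
    Prop where
  row_le : ∀ c d : μ.cells, c.1.1 = d.1.1 → c.1.2 < d.1.2 → T c ≤ T d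
  col_le : ∀ c d : μ.cells, c.1.2 = d.1.2 → c.1.1 < d.1.1 → T c ≤ T d
  unprimed_col : ∀ c d : μ.cells, c.1.2 = d.1.2 → c.1.1 < d.1.1 →
    ∀ a : Fin k, ¬ (T c = toLex (Sum.inl a) ∧ T d = toLex (Sum.inl a))
  primed_row : ∀ c d : μ.cells, c.1.1 = d.1.1 → c.1.2 < d.1.2 →
    ∀ b : Fin l, ¬ (T c = toLex (Sum.inr b) ∧ T d = toLex (Sum.inr b))

open scoped Classical in
/-- The Schur function `S_μ(x₁, …, xₙ)`: the sum of the monomials `x^T` over the semistandard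
tableaux `T` of shape `μ` with entries in `1, …, n`. -/
noncomputable def schur {A : Type*} [CommRing A] (μ : YoungDiagram) {n : ℕ} (x : Fin n → A) : A :=
  ∑ T : μ.cells → Fin n with IsSemistandard T, ∏ c : μ.cells, x (T c)

open scoped Classical in
/-- The hook Schur function `HS_μ(x₁, …, x_k; y₁, …, y_l)`: the sum of the monomials `x^T` over
the `(k, l)`-semistandard tableaux `T` of shape `μ`. -/
noncomputable def hookSchur {A : Type*} [CommRing A] (μ : YoungDiagram) {k l : ℕ}
    (x : Fin k → A) (y : Fin l → A) : A :=
  ∑ T : μ.cells → Fin k ⊕ₗ Fin l with IsHookSemistandard T,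
    ∏ c : μ.cells, Sum.elim x y (ofLex (T c))

/-- The value `∑ m_λ S_λ(x₁, …, xₙ)` of the symmetric function `f = ∑ m_λ S_λ`, which is given
by its finitely supported family of coefficients `m`. -/
noncomputable def schurSum {R A : Type*} [CommRing R] [CommRing A] [Algebra R A]
    (m : YoungDiagram →₀ R) {n : ℕ} (x : Fin n → A) : A :=
  m.sum fun μ r => r • schur μ x

/-- The linear combination `∑ c_λ HS_λ(x₁, …, x_k; y₁, …, y_l)`. -/
noncomputable def hookSchurSum {R A : Type*} [CommRing R] [CommRing A] [Algebra R A]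
    (c : YoungDiagram →₀ R) {k l : ℕ} (x : Fin k → A) (y : Fin l → A) : A :=
  c.sum fun μ r => r • hookSchur μ x y

/-- The symmetric function `∑ m_λ S_λ` is doubly symmetric if, for all finite (possibly empty)
sets of variables `X = {x₁, …, x_k}` and `Y = {y₁, …, y_l}`,
`∑ m_λ S_λ(X, Y) = ∑ m_λ HS_λ(X; Y)`. -/
def IsDoublySymmetric {R : Type*} [CommRing R] (m : YoungDiagram →₀ R) : Prop :=
  ∀ k l : ℕ,
    let x : Fin k → MvPolynomial (Fin k ⊕ Fin l) R := fun a => MvPolynomial.X (Sum.inl a)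
    let y : Fin l → MvPolynomial (Fin k ⊕ Fin l) R := fun b => MvPolynomial.X (Sum.inr b)
    schurSum m (Fin.append x y) = hookSchurSum m x y

/-! Write `U_t` and `V_t` for `stripOp false t` and `stripOp true t`, which remove horizontal and
vertical strips with weight `t` per cell. Peeling the letters off a tableau, largest first, shows
that `S_λ(x)` is the coefficient of `⊥` in `∏ U_{x_i} λ`, and `HS_λ(x; y)` that in `∏ U_{x_i} ∏
V_{y_j} λ`. The `U_t` commute by the Bender–Knuth involution (`commute_stripOp_false`), and a
sign-reversing involution gives `U_t V_{-t} = 1` (`stripOp_false_mul_true`). Hence `V_t` is the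
inverse of `U_{-t}` and all these operators commute. So `f` is doubly symmetric as soon as `V_t f =
U_t f` for every `t`.

To get this, take the hypothesis with a single primed variable and specialise the variables to `s,
x_1, …, x_N` and `-s`. On the hook side `U_s V_{-s}` cancels, so the value does not depend on `s`
and may be compared with `s = 0`: the `⊥`-coefficients of `∏ U_{x_i} U_s U_{-s} f` and `∏ U_{x_i} f`
agree. Linear independence of the Schur functions (`SchurVanishes.eq_zero`) then yields `U_s U_{-s}
f = f`, and applying `V_s`, the inverse of `U_{-s}`, gives `V_s f = U_s f`. -/

namespace YoungDiagram

/-! ### Row lengths and strips. -/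

theorem ext_rowLen {μ ν : YoungDiagram} (h : ∀ i, μ.rowLen i = ν.rowLen i) : μ = ν := by
  ext ⟨i, j⟩
  simp [mem_iff_lt_rowLen, h]

theorem le_iff_rowLen {μ ν : YoungDiagram} : μ ≤ ν ↔ ∀ i, μ.rowLen i ≤ ν.rowLen i := by
  constructor
  · intro h i
    by_contra! hlt
    have := h (mem_iff_lt_rowLen.2 hlt)
    exact absurd (mem_iff_lt_rowLen.1 this) (lt_irrefl _)
  · rintro h ⟨i, j⟩ hc
    exact mem_iff_lt_rowLen.2 ((mem_iff_lt_rowLen.1 hc).trans_le (h i))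

theorem card_le_card_of_le {μ ν : YoungDiagram} (h : μ ≤ ν) : μ.card ≤ ν.card :=
  Finset.card_le_card (cells_subset_iff.2 h)

theorem eq_of_le_of_card_le {μ ν : YoungDiagram} (h : μ ≤ ν) (hc : ν.card ≤ μ.card) : μ = ν :=
  YoungDiagram.ext (Finset.eq_of_subset_of_card_le (cells_subset_iff.2 h) hc)

@[simp]
theorem card_transpose (μ : YoungDiagram) : μ.transpose.card = μ.card := by
  simp [YoungDiagram.card, transpose]

theorem rowLen_eq_zero_of_colLen_le {μ : YoungDiagram} {N : ℕ} (h : μ.colLen 0 ≤ N) :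
    μ.rowLen N = 0 := by
  by_contra h0
  exact absurd (mem_iff_lt_colLen.1 (mem_iff_lt_rowLen.2 (Nat.pos_of_ne_zero h0))) (by omega)

theorem card_eq_sum_rowLen {μ : YoungDiagram} {N : ℕ} (h : μ.rowLen N = 0) :
    μ.card = ∑ i ∈ Finset.range N, μ.rowLen i := by
  rw [YoungDiagram.card, Finset.card_eq_sum_card_fiberwise (f := Prod.fst) (t := Finset.range N)]
  · exact Finset.sum_congr rfl fun i _ => by rw [rowLen_eq_card]; rfl
  · rintro ⟨i, j⟩ hc
    by_contra hi
    have h1 : j < μ.rowLen i := mem_iff_lt_rowLen.1 hc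
    have h2 := μ.rowLen_anti N i (by simpa using hi)
    omega

theorem finite_setOf_le (μ : YoungDiagram) : {ν : YoungDiagram | ν ≤ μ}.Finite := by
  refine Set.Finite.of_finite_image (f := YoungDiagram.cells)
    (μ.cells.powerset.finite_toSet.subset ?_) fun _ _ _ _ h => YoungDiagram.ext h
  rintro _ ⟨ν, hν, rfl⟩
  simpa using hν

/-- The Young diagram of the cells of `μ` that lie in the first `f i` columns for every row `i`
weakly above them. -/
def truncate (μ : YoungDiagram) (f : ℕ → ℕ) : YoungDiagram where
  cells := μ.cells.filter fun c => ∀ i ≤ c.1, c.2 < f i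
  isLowerSet := by
    rintro c d hdc hc
    simp only [Finset.coe_filter, Set.mem_ofPred_eq] at hc ⊢
    exact ⟨μ.isLowerSet hdc hc.1, fun i hi => hdc.2.trans_lt (hc.2 i (hi.trans hdc.1))⟩

theorem rowLen_truncate {μ : YoungDiagram} {f : ℕ → ℕ} (hf : Antitone f)
    (hμ : ∀ i, f i ≤ μ.rowLen i) (i : ℕ) : (μ.truncate f).rowLen i = f i := by
  have key : ∀ j, j < (μ.truncate f).rowLen i ↔ j < f i := by
    intro j
    rw [← mem_iff_lt_rowLen, ← mem_cells]
    simp only [truncate, Finset.mem_filter, mem_cells, mem_iff_lt_rowLen]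
    exact ⟨fun h => h.2 i le_rfl,
      fun h => ⟨h.trans_le (hμ i), fun a ha => h.trans_le (hf ha)⟩⟩
  exact le_antisymm (not_lt.1 fun h => lt_irrefl _ ((key _).1 h))
    (not_lt.1 fun h => lt_irrefl _ ((key _).2 h))

/-- `μ / ν` is a vertical strip (if `p = true`) or a horizontal strip (if `p = false`). -/
structure IsStrip (p : Bool) (ν μ : YoungDiagram) : Prop where
  rowLen_le : ∀ i, ν.rowLen i ≤ μ.rowLen i
  interlace : ∀ i, if p then μ.rowLen i ≤ ν.rowLen i + 1 else μ.rowLen (i + 1) ≤ ν.rowLen i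

theorem IsStrip.le {p : Bool} {ν μ : YoungDiagram} (h : IsStrip p ν μ) : ν ≤ μ :=
  le_iff_rowLen.2 h.rowLen_le

theorem IsStrip.card_le {p : Bool} {ν μ : YoungDiagram} (h : IsStrip p ν μ) : ν.card ≤ μ.card :=
  card_le_card_of_le h.le

theorem isStrip_false_iff {ν μ : YoungDiagram} : IsStrip false ν μ ↔
    (∀ i, ν.rowLen i ≤ μ.rowLen i) ∧ ∀ i, μ.rowLen (i + 1) ≤ ν.rowLen i :=
  ⟨fun h => ⟨h.1, by simpa using h.2⟩, fun h => ⟨h.1, by simpa using h.2⟩⟩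

theorem isStrip_true_iff {ν μ : YoungDiagram} : IsStrip true ν μ ↔
    (∀ i, ν.rowLen i ≤ μ.rowLen i) ∧ ∀ i, μ.rowLen i ≤ ν.rowLen i + 1 :=
  ⟨fun h => ⟨h.1, by simpa using h.2⟩, fun h => ⟨h.1, by simpa using h.2⟩⟩

theorem isStrip_self (p : Bool) (μ : YoungDiagram) : IsStrip p μ μ := by
  cases p
  · exact isStrip_false_iff.2 ⟨fun _ => le_rfl, fun i => μ.rowLen_anti _ _ (Nat.le_add_right i 1)⟩
  · exact isStrip_true_iff.2 ⟨fun _ => le_rfl, fun i => Nat.le_succ _⟩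

/-- Row-length inequalities suit the involutions below; this cellwise form suits tableaux and
transposition. -/
theorem isStrip_false_iff_cells {ν μ : YoungDiagram} : IsStrip false ν μ ↔
    ν ≤ μ ∧ ∀ i i' j, i < i' → (i', j) ∈ μ → (i, j) ∈ ν := by
  rw [isStrip_false_iff, ← le_iff_rowLen]
  refine and_congr_right fun _ => ⟨fun h i i' j hi hc => ?_, fun h i => ?_⟩
  · rw [mem_iff_lt_rowLen] at hc ⊢
    exact hc.trans_le ((μ.rowLen_anti _ _ hi).trans (h i))
  · by_contra! hlt
    exact lt_irrefl _ (mem_iff_lt_rowLen.1 (h i (i + 1) _ i.lt_succ_self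
      (mem_iff_lt_rowLen.2 hlt)))

theorem isStrip_true_iff_cells {ν μ : YoungDiagram} : IsStrip true ν μ ↔
    ν ≤ μ ∧ ∀ i j j', j < j' → (i, j') ∈ μ → (i, j) ∈ ν := by
  rw [isStrip_true_iff, ← le_iff_rowLen]
  refine and_congr_right fun _ => ⟨fun h i j j' hj hc => ?_, fun h i => ?_⟩
  · rw [mem_iff_lt_rowLen] at hc ⊢
    have := h i
    omega
  · by_contra! hlt
    exact lt_irrefl _ (mem_iff_lt_rowLen.1 (h i _ _ (Nat.lt_succ_self _)
      (mem_iff_lt_rowLen.2 hlt)))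

theorem isStrip_transpose {p : Bool} {ν μ : YoungDiagram} :
    IsStrip p ν.transpose μ.transpose ↔ IsStrip (!p) ν μ := by
  cases p
  · rw [isStrip_false_iff_cells, Bool.not_false, isStrip_true_iff_cells, transpose_le_iff]
    simp only [mem_transpose, Prod.swap_prod_mk]
    exact and_congr_right fun _ => ⟨fun h i j j' => h j j' i, fun h i i' j => h j i i'⟩
  · rw [isStrip_true_iff_cells, Bool.not_true, isStrip_false_iff_cells, transpose_le_iff]
    simp only [mem_transpose, Prod.swap_prod_mk]
    exact and_congr_right fun _ => ⟨fun h i i' j => h j i i', fun h i j j' => h j j' i⟩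

/-- The Young diagrams obtained from `μ` by removing a vertical strip (if `p = true`) or a
horizontal strip (if `p = false`). -/
noncomputable def strips (p : Bool) (μ : YoungDiagram) : Finset YoungDiagram :=
  (μ.finite_setOf_le.subset fun _ (h : IsStrip p _ μ) => h.le).toFinset

@[simp]
theorem mem_strips {p : Bool} {ν μ : YoungDiagram} : ν ∈ strips p μ ↔ IsStrip p ν μ :=
  Set.Finite.mem_toFinset _

/-- The largest possible length of row `i` of a diagram `ν` for which `μ / ν` and `ν / ρ` are
horizontal strips. -/
def interlaceUpper (μ ρ : YoungDiagram) : ℕ → ℕ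
  | 0 => μ.rowLen 0
  | i + 1 => min (μ.rowLen (i + 1)) (ρ.rowLen i)

/-- The Bender–Knuth involution on the diagrams `ν` for which `μ / ν` and `ν / ρ` are horizontal
strips: it reflects every row length in the interval of its possible values. -/
def benderKnuth (μ ρ ν : YoungDiagram) : YoungDiagram :=
  μ.truncate fun i =>
    max (ρ.rowLen i) (μ.rowLen (i + 1)) + interlaceUpper μ ρ i - ν.rowLen i

/-! ### The Bender–Knuth involution on chains of two horizontal strips. -/

section BenderKnuth

variable {μ ν ρ : YoungDiagram}

theorem interlaceUpper_le (μ ρ : YoungDiagram) (i : ℕ) : interlaceUpper μ ρ i ≤ μ.rowLen i := by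
  cases i
  · exact le_rfl
  · exact min_le_left _ _

theorem rowLen_le_interlaceUpper (h₁ : IsStrip false ν μ) (h₂ : IsStrip false ρ ν) (i : ℕ) :
    ν.rowLen i ≤ interlaceUpper μ ρ i := by
  rw [isStrip_false_iff] at h₁ h₂
  cases i
  · exact h₁.1 0
  · exact le_min (h₁.1 _) (h₂.2 _)

theorem max_le_rowLen (h₁ : IsStrip false ν μ) (h₂ : IsStrip false ρ ν) (i : ℕ) :
    max (ρ.rowLen i) (μ.rowLen (i + 1)) ≤ ν.rowLen i := by
  rw [isStrip_false_iff] at h₁ h₂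
  exact max_le (h₂.1 i) (h₁.2 i)

/-- The reflected lengths still decrease: the upper end for row `i + 1` is at most `ρ.rowLen i`,
hence at most the lower end for row `i`. -/
theorem rowLen_benderKnuth (h₁ : IsStrip false ν μ) (h₂ : IsStrip false ρ ν) (i : ℕ) :
    (benderKnuth μ ρ ν).rowLen i =
      max (ρ.rowLen i) (μ.rowLen (i + 1)) + interlaceUpper μ ρ i - ν.rowLen i := by
  refine rowLen_truncate (antitone_nat_of_succ_le fun i => ?_) (fun i => ?_) i
  · have ha := max_le_rowLen h₁ h₂ (i + 1)
    have hb := rowLen_le_interlaceUpper h₁ h₂ i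
    have hc : interlaceUpper μ ρ (i + 1) = min (μ.rowLen (i + 1)) (ρ.rowLen i) := rfl
    omega
  · have ha := max_le_rowLen h₁ h₂ i
    have hb := interlaceUpper_le μ ρ i
    omega

theorem isStrip_benderKnuth_left (h₁ : IsStrip false ν μ) (h₂ : IsStrip false ρ ν) :
    IsStrip false (benderKnuth μ ρ ν) μ := by
  refine isStrip_false_iff.2 ⟨fun i => ?_, fun i => ?_⟩ <;>
  · rw [rowLen_benderKnuth h₁ h₂]
    have ha := max_le_rowLen h₁ h₂ i
    have hb := interlaceUpper_le μ ρ i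
    have hc := rowLen_le_interlaceUpper h₁ h₂ i
    omega

theorem isStrip_benderKnuth_right (h₁ : IsStrip false ν μ) (h₂ : IsStrip false ρ ν) :
    IsStrip false ρ (benderKnuth μ ρ ν) := by
  refine isStrip_false_iff.2 ⟨fun i => ?_, fun i => ?_⟩
  · rw [rowLen_benderKnuth h₁ h₂]
    have hc := rowLen_le_interlaceUpper h₁ h₂ i
    omega
  · rw [rowLen_benderKnuth h₁ h₂]
    have ha := max_le_rowLen h₁ h₂ (i + 1)
    have hc : interlaceUpper μ ρ (i + 1) = min (μ.rowLen (i + 1)) (ρ.rowLen i) := rfl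
    omega

theorem benderKnuth_benderKnuth (h₁ : IsStrip false ν μ) (h₂ : IsStrip false ρ ν) :
    benderKnuth μ ρ (benderKnuth μ ρ ν) = ν := by
  refine ext_rowLen fun i => ?_
  rw [rowLen_benderKnuth (isStrip_benderKnuth_left h₁ h₂) (isStrip_benderKnuth_right h₁ h₂),
    rowLen_benderKnuth h₁ h₂]
  have hc := rowLen_le_interlaceUpper h₁ h₂ i
  omega

/-- Reflection makes the two lengths of a row add up to the sum of the interval's ends. Over all
rows the ends pair up as `min + max` of `μ.rowLen (i + 1)` and `ρ.rowLen i`. Thus the sizes of the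
two strips are exchanged. -/
theorem card_benderKnuth (h₁ : IsStrip false ν μ) (h₂ : IsStrip false ρ ν) :
    (benderKnuth μ ρ ν).card + ν.card = μ.card + ρ.card := by
  have hμ : μ.rowLen (μ.colLen 0) = 0 := rowLen_eq_zero_of_colLen_le le_rfl
  have hμ' : μ.rowLen (μ.colLen 0 + 1) = 0 := rowLen_eq_zero_of_colLen_le (Nat.le_succ _)
  set N := μ.colLen 0
  have hle : ∀ {κ : YoungDiagram}, κ ≤ μ → κ.rowLen N = 0 := fun h =>
    Nat.eq_zero_of_le_zero (hμ ▸ le_iff_rowLen.1 h N)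
  have hle' : ∀ {κ : YoungDiagram}, κ ≤ μ → κ.rowLen (N + 1) = 0 := fun h =>
    Nat.eq_zero_of_le_zero (hμ' ▸ le_iff_rowLen.1 h (N + 1))
  rw [card_eq_sum_rowLen (hle' (isStrip_benderKnuth_left h₁ h₂).le),
    card_eq_sum_rowLen (hle' h₁.le), card_eq_sum_rowLen hμ', card_eq_sum_rowLen
    (hle (h₂.le.trans h₁.le)), ← Finset.sum_add_distrib]
  have h : ∀ i ∈ Finset.range (N + 1), (benderKnuth μ ρ ν).rowLen i + ν.rowLen i =
      interlaceUpper μ ρ i + max (ρ.rowLen i) (μ.rowLen (i + 1)) := fun i _ => by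
    rw [rowLen_benderKnuth h₁ h₂]
    have hc := rowLen_le_interlaceUpper h₁ h₂ i
    omega
  -- With `N + 1` rows, row `0` splits off the upper ends and row `N`, where the lower end is zero,
  -- off the lower ends; what remains pairs index by index.
  rw [Finset.sum_congr rfl h, Finset.sum_add_distrib, Finset.sum_range_succ',
    Finset.sum_range_succ, Finset.sum_range_succ', hle (h₂.le.trans h₁.le), hμ']
  simp only [interlaceUpper, max_self]
  have h2 : ∀ i, min (μ.rowLen (i + 1)) (ρ.rowLen i) + max (ρ.rowLen i) (μ.rowLen (i + 1)) =
    μ.rowLen (i + 1) + ρ.rowLen i := fun i => by omega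
  have h3 := Finset.sum_congr (s₁ := Finset.range N) rfl fun i _ => h2 i
  rw [Finset.sum_add_distrib, Finset.sum_add_distrib] at h3
  omega

end BenderKnuth

/-- The first row in which `μ` and `ρ` differ (`0` if there is none). -/
noncomputable def firstDiff (μ ρ : YoungDiagram) : ℕ :=
  sInf {i | μ.rowLen i ≠ ρ.rowLen i}

/-- The involution that moves the last cell of row `firstDiff μ ρ` of `μ` into or out of `ν`. -/
noncomputable def toggle (μ ρ ν : YoungDiagram) : YoungDiagram :=
  μ.truncate fun i =>
    if i = firstDiff μ ρ then 2 * μ.rowLen i - 1 - ν.rowLen i else ν.rowLen i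

/-! ### The sign-reversing involution on a vertical strip followed by a horizontal one. -/

section Toggle

variable {μ ν ρ : YoungDiagram}

theorem rowLen_firstDiff_ne (h : μ ≠ ρ) :
    μ.rowLen (firstDiff μ ρ) ≠ ρ.rowLen (firstDiff μ ρ) := by
  refine Nat.sInf_mem (s := {i | μ.rowLen i ≠ ρ.rowLen i}) ?_
  by_contra! h0
  exact h (ext_rowLen fun i => by
    by_contra hi
    exact (Set.eq_empty_iff_forall_notMem.1 h0 i) hi)

theorem rowLen_eq_of_lt_firstDiff {i : ℕ} (h : i < firstDiff μ ρ) : μ.rowLen i = ρ.rowLen i := by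
  by_contra hi
  exact Nat.notMem_of_lt_sInf h hi

/-- Let `r` be the first row where `μ` and `ρ` differ. Then `ρ.rowLen r < μ.rowLen r`, so `ν.rowLen
r` may be either `μ.rowLen r - 1` or `μ.rowLen r`, and the formula swaps the two. The rows above are
full, and row `r + 1` of `ν` is at most `ρ.rowLen r`, so the result is still a diagram. -/
theorem rowLen_toggle (h : μ ≠ ρ) (h₁ : IsStrip true ν μ) (h₂ : IsStrip false ρ ν) (i : ℕ) :
    (toggle μ ρ ν).rowLen i =
      if i = firstDiff μ ρ then 2 * μ.rowLen i - 1 - ν.rowLen i else ν.rowLen i := by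
  have hne := rowLen_firstDiff_ne h
  rw [isStrip_true_iff] at h₁
  rw [isStrip_false_iff] at h₂
  refine rowLen_truncate (antitone_nat_of_succ_le fun i => ?_) (fun i => ?_) i
  · have e0 := ν.rowLen_anti _ _ (Nat.le_add_right i 1)
    have e1 := μ.rowLen_anti _ _ (Nat.le_add_right i 1)
    have e2 := h₁.1 i
    have e3 := h₁.2 i
    have e4 := h₂.1 i
    have e5 := h₂.2 i
    have e6 := h₁.1 (i + 1)
    have e7 := h₁.2 (i + 1)
    split_ifs with c1 c2 c2
    · omega
    · have := rowLen_eq_of_lt_firstDiff (μ := μ) (ρ := ρ) (i := i) (by omega)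
      omega
    · rw [← c2] at hne
      omega
    · exact e0
  · have e2 := h₁.1 i
    have e3 := h₁.2 i
    split_ifs with c1 <;> omega

theorem isStrip_toggle_left (h : μ ≠ ρ) (h₁ : IsStrip true ν μ) (h₂ : IsStrip false ρ ν) :
    IsStrip true (toggle μ ρ ν) μ := by
  have hne := rowLen_firstDiff_ne h
  have h₁' := isStrip_true_iff.1 h₁
  have h₂' := isStrip_false_iff.1 h₂
  refine isStrip_true_iff.2 ⟨fun i => ?_, fun i => ?_⟩ <;>
  · rw [rowLen_toggle h h₁ h₂]
    have e2 := h₁'.1 i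
    have e3 := h₁'.2 i
    split_ifs <;> omega

theorem isStrip_toggle_right (h : μ ≠ ρ) (h₁ : IsStrip true ν μ) (h₂ : IsStrip false ρ ν) :
    IsStrip false ρ (toggle μ ρ ν) := by
  have hne := rowLen_firstDiff_ne h
  have h₁' := isStrip_true_iff.1 h₁
  have h₂' := isStrip_false_iff.1 h₂
  refine isStrip_false_iff.2 ⟨fun i => ?_, fun i => ?_⟩
  · rw [rowLen_toggle h h₁ h₂]
    have e2 := h₁'.1 i
    have e3 := h₁'.2 i
    have e4 := h₂'.1 i
    split_ifs with c1
    · rw [← c1] at hne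
      omega
    · omega
  · rw [rowLen_toggle h h₁ h₂]
    have e5 := h₂'.2 i
    have e6 := h₁'.2 (i + 1)
    have e7 := μ.rowLen_anti _ _ (Nat.le_add_right i 1)
    split_ifs with c1
    · have := rowLen_eq_of_lt_firstDiff (μ := μ) (ρ := ρ) (i := i) (by omega)
      omega
    · omega

theorem toggle_toggle (h : μ ≠ ρ) (h₁ : IsStrip true ν μ) (h₂ : IsStrip false ρ ν) :
    toggle μ ρ (toggle μ ρ ν) = ν := by
  refine ext_rowLen fun i => ?_
  rw [rowLen_toggle h (isStrip_toggle_left h h₁ h₂) (isStrip_toggle_right h h₁ h₂),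
    rowLen_toggle h h₁ h₂]
  have hne := rowLen_firstDiff_ne h
  have e2 := (isStrip_true_iff.1 h₁).1 i
  have e3 := (isStrip_true_iff.1 h₁).2 i
  have e4 := (isStrip_false_iff.1 h₂).1 i
  split_ifs with c1
  · rw [← c1] at hne
    omega
  · rfl

theorem card_toggle (h : μ ≠ ρ) (h₁ : IsStrip true ν μ) (h₂ : IsStrip false ρ ν) :
    (toggle μ ρ ν).card = ν.card + 1 ∨ ν.card = (toggle μ ρ ν).card + 1 := by
  have hμ : μ.rowLen (μ.colLen 0) = 0 := rowLen_eq_zero_of_colLen_le le_rfl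
  have hle : ∀ {κ : YoungDiagram}, κ ≤ μ → κ.rowLen (μ.colLen 0) = 0 := fun h =>
    Nat.eq_zero_of_le_zero ((le_iff_rowLen.1 h _).trans hμ.le)
  have hne := rowLen_firstDiff_ne h
  have e1 := (isStrip_true_iff.1 h₁).1 (firstDiff μ ρ)
  have e2 := (isStrip_true_iff.1 h₁).2 (firstDiff μ ρ)
  have e3 := (isStrip_false_iff.1 h₂).1 (firstDiff μ ρ)
  have hmem : firstDiff μ ρ ∈ Finset.range (μ.colLen 0) := by
    rw [Finset.mem_range, ← mem_iff_lt_colLen, mem_iff_lt_rowLen]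
    omega
  rw [card_eq_sum_rowLen (hle (isStrip_toggle_left h h₁ h₂).le),
    card_eq_sum_rowLen (hle h₁.le), ← Finset.add_sum_erase _ _ hmem,
    ← Finset.add_sum_erase _ (fun i => ν.rowLen i) hmem]
  have hs : ∑ i ∈ (Finset.range (μ.colLen 0)).erase (firstDiff μ ρ), (toggle μ ρ ν).rowLen i =
      ∑ i ∈ (Finset.range (μ.colLen 0)).erase (firstDiff μ ρ), ν.rowLen i :=
    Finset.sum_congr rfl fun i hi => by
      rw [rowLen_toggle h h₁ h₂, if_neg (Finset.ne_of_mem_erase hi)]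
  rw [hs, rowLen_toggle h h₁ h₂, if_pos rfl]
  omega

end Toggle

end YoungDiagram

open YoungDiagram

/-! ### The algebra of the strip-removing operators. -/

section StripOp

variable {A : Type*} [CommRing A]

/-- The operator on formal combinations of Young diagrams that removes a vertical strip (if
`p = true`) or a horizontal strip (if `p = false`) in all possible ways, with weight `t` for every
removed cell. -/
noncomputable def stripOp (p : Bool) (t : A) : Module.End A (YoungDiagram →₀ A) :=
  Finsupp.linearCombination A fun μ =>
    ∑ ν ∈ strips p μ, Finsupp.single ν (t ^ (μ.card - ν.card))

theorem stripOp_single (p : Bool) (t : A) (μ : YoungDiagram) :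
    stripOp p t (Finsupp.single μ 1) =
      ∑ ν ∈ strips p μ, Finsupp.single ν (t ^ (μ.card - ν.card)) := by
  simp [stripOp]

theorem stripOp_single' (p : Bool) (t : A) (μ : YoungDiagram) (a : A) :
    stripOp p t (Finsupp.single μ a) =
      ∑ ν ∈ strips p μ, Finsupp.single ν (a * t ^ (μ.card - ν.card)) := by
  simp [stripOp, Finset.smul_sum]

theorem stripOp_stripOp_single (p q : Bool) (s t : A) (μ : YoungDiagram) :
    stripOp p s (stripOp q t (Finsupp.single μ 1)) =
      ∑ x ∈ (strips q μ).sigma fun ν => strips p ν,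
        Finsupp.single x.2 (t ^ (μ.card - x.1.card) * s ^ (x.1.card - x.2.card)) := by
  simp only [stripOp_single', map_sum, one_mul, Finset.sum_sigma]

theorem End.ext_single {f g : Module.End A (YoungDiagram →₀ A)}
    (h : ∀ μ, f (Finsupp.single μ 1) = g (Finsupp.single μ 1)) : f = g :=
  Finsupp.lhom_ext' fun μ => LinearMap.ext_ring (h μ)

/-- For fixed `μ` and `ρ`, the Bender–Knuth involution on the middle diagram exchanges the sizes of
the two strips, hence the exponents of `s` and `t`. -/
theorem commute_stripOp_false (s t : A) : Commute (stripOp false s) (stripOp false t) := by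
  refine End.ext_single fun μ => ?_
  rw [Module.End.mul_apply, Module.End.mul_apply, stripOp_stripOp_single, stripOp_stripOp_single]
  refine Finset.sum_nbij' (fun x => ⟨benderKnuth μ x.2 x.1, x.2⟩)
    (fun x => ⟨benderKnuth μ x.2 x.1, x.2⟩) ?_ ?_ ?_ ?_ ?_ <;>
  · rintro ⟨ν, ρ⟩ h
    simp only [Finset.mem_sigma, mem_strips] at h ⊢
    obtain ⟨h₁, h₂⟩ := h
    first
    | exact ⟨isStrip_benderKnuth_left h₁ h₂, isStrip_benderKnuth_right h₁ h₂⟩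
    | rw [benderKnuth_benderKnuth h₁ h₂]
    | have e1 := card_benderKnuth h₁ h₂
      have e2 := h₁.card_le
      have e3 := h₂.card_le
      rw [mul_comm, show μ.card - (benderKnuth μ ρ ν).card = ν.card - ρ.card by omega,
        show (benderKnuth μ ρ ν).card - ρ.card = μ.card - ν.card by omega]

/-- Toggling moves one cell between the vertical and the horizontal strip, which flips the sign of
the weight. All chains ending at `ρ ≠ μ` cancel in pairs; the trivial chain at `μ` survives. -/
theorem stripOp_false_mul_true (t : A) : stripOp false t * stripOp true (-t) = 1 := by
  classical
  refine End.ext_single fun μ => ?_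
  rw [Module.End.mul_apply, Module.End.one_apply, stripOp_stripOp_single,
    ← Finset.add_sum_erase _ _ (a := ⟨μ, μ⟩)
      (by simpa only [Finset.mem_sigma, mem_strips] using ⟨isStrip_self _ μ, isStrip_self _ μ⟩)]
  rw [Finset.sum_involution (fun x _ => ⟨toggle μ x.2 x.1, x.2⟩)]
  · simp
  all_goals
    rintro ⟨ν, ρ⟩ h
    simp only [Finset.mem_erase, Finset.mem_sigma, mem_strips] at h
    obtain ⟨hne, h₁, h₂⟩ := h
    have hμρ : μ ≠ ρ := by
      rintro rfl
      exact hne (by rw [le_antisymm h₁.le h₂.le])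
  · have e1 := card_toggle hμρ h₁ h₂
    have e2 := (isStrip_toggle_left hμρ h₁ h₂).card_le
    have e3 := (isStrip_toggle_right hμρ h₁ h₂).card_le
    have e4 := h₁.card_le
    have e5 := h₂.card_le
    simp only
    rw [← Finsupp.single_add]
    obtain e1 | e1 := e1
    · rw [show μ.card - ν.card = μ.card - (toggle μ ρ ν).card + 1 by omega,
        show (toggle μ ρ ν).card - ρ.card = ν.card - ρ.card + 1 by omega]
      exact (congrArg (Finsupp.single ρ) (by ring)).trans (Finsupp.single_zero ρ)
    · rw [show μ.card - (toggle μ ρ ν).card = μ.card - ν.card + 1 by omega,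
        show ν.card - ρ.card = (toggle μ ρ ν).card - ρ.card + 1 by omega]
      exact (congrArg (Finsupp.single ρ) (by ring)).trans (Finsupp.single_zero ρ)
  · intro _ heq
    have e1 := card_toggle hμρ h₁ h₂
    rw [show toggle μ ρ ν = ν from congrArg Sigma.fst heq] at e1
    omega
  · simp only [Finset.mem_erase, Finset.mem_sigma, mem_strips]
    exact ⟨fun heq => hμρ (congrArg Sigma.snd heq).symm, isStrip_toggle_left hμρ h₁ h₂,
      isStrip_toggle_right hμρ h₁ h₂⟩
  · simp only
    rw [toggle_toggle hμρ h₁ h₂]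

theorem stripOp_mapDomain_transpose (p : Bool) (t : A) (F : YoungDiagram →₀ A) :
    stripOp p t (Finsupp.mapDomain transpose F) =
      Finsupp.mapDomain transpose (stripOp (!p) t F) := by
  have : stripOp p t ∘ₗ Finsupp.lmapDomain A A transpose =
      Finsupp.lmapDomain A A transpose ∘ₗ stripOp (!p) t := by
    refine End.ext_single fun μ => ?_
    simp only [LinearMap.comp_apply, Finsupp.lmapDomain_apply, Finsupp.mapDomain_single,
      stripOp_single, Finsupp.mapDomain_finsetSum]
    refine Finset.sum_nbij' transpose transpose ?_ ?_ ?_ ?_ ?_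
    · intro ν h
      rw [mem_strips] at h ⊢
      rw [← isStrip_transpose]
      simpa using h
    · intro ν h
      rw [mem_strips] at h ⊢
      exact isStrip_transpose.2 h
    all_goals simp
  exact LinearMap.congr_fun this F

/-- A one-sided inverse is not enough to form a unit. Transposition exchanges the two kinds of strip
and turns the previous identity, at `-t`, into this one. -/
theorem stripOp_true_mul_false (t : A) : stripOp true (-t) * stripOp false t = 1 := by
  refine LinearMap.ext fun F => ?_
  have h := LinearMap.congr_fun (stripOp_false_mul_true (-t)) (Finsupp.mapDomain transpose F)
  rw [neg_neg, Module.End.mul_apply, Module.End.one_apply, stripOp_mapDomain_transpose,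
    stripOp_mapDomain_transpose] at h
  refine Finsupp.mapDomain_injective (fun _ _ => transpose_eq_iff.1) ?_
  simpa using h

/-- `stripOp false t` as a unit, with inverse `stripOp true (-t)`. -/
noncomputable def stripUnit (t : A) : (Module.End A (YoungDiagram →₀ A))ˣ where
  val := stripOp false t
  inv := stripOp true (-t)
  val_inv := stripOp_false_mul_true t
  inv_val := stripOp_true_mul_false t

/-- Removing vertical strips is the inverse of a `stripOp false`, and whatever commutes with a unit
commutes with its inverse. -/
theorem commute_stripOp (p q : Bool) (s t : A) : Commute (stripOp p s) (stripOp q t) := by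
  have h : ∀ s t : A, Commute (stripOp false s) (stripOp true t) := fun s t => by
    have := (show Commute (stripOp false s) (stripUnit (-t)) from
      commute_stripOp_false s (-t)).units_inv_right
    simpa [stripUnit] using this
  cases p <;> cases q
  · exact commute_stripOp_false s t
  · exact h s t
  · exact (h t s).symm
  · have := (show Commute (stripOp true s) (stripUnit (-t)) from (h (-t) s).symm).units_inv_right
    simpa [stripUnit] using this

theorem stripOp_zero (p : Bool) : stripOp p (0 : A) = 1 := by
  refine End.ext_single fun μ => ?_
  rw [stripOp_single, Finset.sum_eq_single μ]
  · simp
  · intro ν hν hne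
    rw [mem_strips] at hν
    have : μ.card - ν.card ≠ 0 := fun h0 => hne (eq_of_le_of_card_le hν.le (by omega))
    simp [this]
  · intro h
    exact absurd (mem_strips.2 (isStrip_self p μ)) h

end StripOp

/-! ### Schur and hook Schur functions as coefficients of operator products. -/

section Tableau

/-- A filling of the cells of `μ` by an alphabet with marked (`p a = true`) and unmarked
(`p a = false`) letters is semistandard if its entries are weakly increasing along rows and down
columns, no marked letter is repeated in a row, and no unmarked letter is repeated in a column. -/
structure IsMarkedSemistandard {α : Type*} [LinearOrder α] (p : α → Bool) {μ : YoungDiagram}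
    (T : μ.cells → α) : Prop where
  row_le : ∀ c d : μ.cells, c.1.1 = d.1.1 → c.1.2 < d.1.2 → T c ≤ T d
  col_le : ∀ c d : μ.cells, c.1.2 = d.1.2 → c.1.1 < d.1.1 → T c ≤ T d
  row_marked : ∀ c d : μ.cells, c.1.1 = d.1.1 → c.1.2 < d.1.2 → T c = T d → p (T c) = false
  col_marked : ∀ c d : μ.cells, c.1.2 = d.1.2 → c.1.1 < d.1.1 → T c = T d → p (T c) = true

variable {A : Type*} [CommRing A]

open scoped Classical in
/-- The sum of the monomials of the semistandard fillings of `μ` by a marked alphabet. -/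
noncomputable def markedSchur {α : Type*} [LinearOrder α] [Fintype α] (p : α → Bool) (x : α → A)
    (μ : YoungDiagram) : A :=
  ∑ T : μ.cells → α with IsMarkedSemistandard p T, ∏ c : μ.cells, x (T c)

theorem schur_eq_markedSchur (μ : YoungDiagram) {n : ℕ} (x : Fin n → A) :
    schur μ x = markedSchur (fun _ => false) x μ := by
  classical
  refine Finset.sum_congr (Finset.filter_congr fun T _ => ⟨fun h => ?_, fun h => ?_⟩) fun _ _ => rfl
  · exact ⟨h.row_le, fun c d h1 h2 => (h.col_lt c d h1 h2).le, fun _ _ _ _ _ => rfl,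
      fun c d h1 h2 h3 => absurd h3 (h.col_lt c d h1 h2).ne⟩
  · exact ⟨h.row_le, fun c d h1 h2 => (h.col_le c d h1 h2).lt_of_ne fun h3 =>
      Bool.false_ne_true (h.col_marked c d h1 h2 h3)⟩

theorem hookSchur_eq_markedSchur (μ : YoungDiagram) {k l : ℕ} (x : Fin k → A) (y : Fin l → A) :
    hookSchur μ x y = markedSchur (α := Fin k ⊕ₗ Fin l)
      (fun a => Sum.elim (fun _ => false) (fun _ => true) (ofLex a))
      (fun a => Sum.elim x y (ofLex a)) μ := by
  classical
  refine Finset.sum_congr (Finset.filter_congr fun T _ => ⟨fun h => ?_, fun h => ?_⟩) fun _ _ => rfl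
  · refine ⟨h.row_le, h.col_le, fun c d h1 h2 h3 => ?_, fun c d h1 h2 h3 => ?_⟩
    · rcases ha : ofLex (T c) with a | b
      · rfl
      · have hc : T c = toLex (Sum.inr b) := ha
        exact absurd ⟨hc, h3 ▸ hc⟩ (h.primed_row c d h1 h2 b)
    · rcases ha : ofLex (T c) with a | b
      · have hc : T c = toLex (Sum.inl a) := ha
        exact absurd ⟨hc, h3 ▸ hc⟩ (h.unprimed_col c d h1 h2 a)
      · rfl
  · refine ⟨h.row_le, h.col_le, fun c d h1 h2 a h3 => ?_, fun c d h1 h2 b h3 => ?_⟩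
    · have := h.col_marked c d h1 h2 (h3.1.trans h3.2.symm)
      rw [h3.1] at this
      exact Bool.false_ne_true this
    · have := h.row_marked c d h1 h2 (h3.1.trans h3.2.symm)
      rw [h3.1] at this
      exact Bool.false_ne_true this.symm

/-- Relabelling carries the alphabet `Fin k ⊕ₗ Fin l` to `Fin (k + l)`, where one can induct on the
last letter. -/
theorem markedSchur_orderIso {α β : Type*} [LinearOrder α] [Fintype α] [LinearOrder β] [Fintype β]
    (e : α ≃o β) (p : β → Bool) (x : β → A) (μ : YoungDiagram) :
    markedSchur (fun a => p (e a)) (fun a => x (e a)) μ = markedSchur p x μ := by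
  classical
  refine Finset.sum_equiv (Equiv.arrowCongr (Equiv.refl _) e.toEquiv) (fun T => ?_) fun T _ => rfl
  simp only [Finset.mem_filter, Finset.mem_univ, true_and]
  have hT : Equiv.arrowCongr (Equiv.refl _) e.toEquiv T = fun c => e (T c) := rfl
  rw [hT]
  constructor
  · rintro ⟨h1, h2, h3, h4⟩
    exact ⟨fun c d a b => e.monotone (h1 c d a b), fun c d a b => e.monotone (h2 c d a b),
      fun c d a b h => h3 c d a b (e.injective h), fun c d a b h => h4 c d a b (e.injective h)⟩
  · rintro ⟨h1, h2, h3, h4⟩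
    exact ⟨fun c d a b => e.le_iff_le.1 (h1 c d a b), fun c d a b => e.le_iff_le.1 (h2 c d a b),
      fun c d a b h => h3 c d a b (congrArg e h), fun c d a b h => h4 c d a b (congrArg e h)⟩

/-- The ordered sum of `Fin k` and `Fin l` is `Fin (k + l)`. -/
def finSumLexIso (k l : ℕ) : Fin k ⊕ₗ Fin l ≃o Fin (k + l) where
  toEquiv := ofLex.trans finSumFinEquiv
  map_rel_iff' := by
    intro a b
    rw [Equiv.trans_apply, Equiv.trans_apply, Sum.Lex.le_def]
    rcases ofLex a with a | a <;> rcases ofLex b with b | b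
    · simp only [finSumFinEquiv_apply_left, Sum.lex_inl_inl]
      exact Iff.rfl
    · simp only [finSumFinEquiv_apply_left, finSumFinEquiv_apply_right, Sum.Lex.sep, iff_true]
      rw [Fin.le_def, Fin.val_castAdd, Fin.val_natAdd]
      omega
    · simp only [finSumFinEquiv_apply_left, finSumFinEquiv_apply_right, Sum.lex_inr_inl, iff_false]
      rw [Fin.le_def, Fin.val_castAdd, Fin.val_natAdd]
      omega
    · simp

/-- Extend a filling of `ν` to `μ` by the last letter. -/
def extendFilling {n : ℕ} {ν : YoungDiagram} (μ : YoungDiagram) (T : ν.cells → Fin n) :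
    μ.cells → Fin (n + 1) :=
  fun c => if h : c.1 ∈ ν.cells then (T ⟨c.1, h⟩).castSucc else Fin.last n

theorem extendFilling_of_mem {n : ℕ} {ν μ : YoungDiagram} (T : ν.cells → Fin n) (c : μ.cells)
    (h : c.1 ∈ ν.cells) : extendFilling μ T c = (T ⟨c.1, h⟩).castSucc := dif_pos h

theorem extendFilling_of_notMem {n : ℕ} {ν μ : YoungDiagram} (T : ν.cells → Fin n) (c : μ.cells)
    (h : c.1 ∉ ν.cells) : extendFilling μ T c = Fin.last n := dif_neg h

theorem extendFilling_eq_last_iff {n : ℕ} {ν μ : YoungDiagram} (T : ν.cells → Fin n)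
    (c : μ.cells) : extendFilling μ T c = Fin.last n ↔ c.1 ∉ ν.cells := by
  by_cases h : c.1 ∈ ν.cells
  · simp [extendFilling_of_mem T c h, h]
  · simp [extendFilling_of_notMem T c h, h]

theorem isMarkedSemistandard_extendFilling {n : ℕ} {ν μ : YoungDiagram} {p : Fin (n + 1) → Bool}
    {T : ν.cells → Fin n} (hT : IsMarkedSemistandard (fun a => p a.castSucc) T)
    (h : IsStrip (p (Fin.last n)) ν μ) : IsMarkedSemistandard p (extendFilling μ T) := by
  have hν : ∀ c d : μ.cells, c.1.1 ≤ d.1.1 → c.1.2 ≤ d.1.2 → d.1 ∈ ν.cells → c.1 ∈ ν.cells :=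
    fun c d h1 h2 hd => ν.isLowerSet (a := d.1) (b := c.1) ⟨h1, h2⟩ hd
  refine ⟨fun c d h1 h2 => ?_, fun c d h1 h2 => ?_, fun c d h1 h2 => ?_, fun c d h1 h2 => ?_⟩ <;>
    by_cases hd : d.1 ∈ ν.cells
  · have hc := hν c d h1.le h2.le hd
    rw [extendFilling_of_mem T c hc, extendFilling_of_mem T d hd]
    exact Fin.castSucc_le_castSucc_iff.2 (hT.row_le ⟨c, hc⟩ ⟨d, hd⟩ h1 h2)
  · exact (extendFilling_of_notMem T d hd).symm ▸ Fin.le_last _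
  · have hc := hν c d h2.le h1.le hd
    rw [extendFilling_of_mem T c hc, extendFilling_of_mem T d hd]
    exact Fin.castSucc_le_castSucc_iff.2 (hT.col_le ⟨c, hc⟩ ⟨d, hd⟩ h1 h2)
  · exact (extendFilling_of_notMem T d hd).symm ▸ Fin.le_last _
  · have hc := hν c d h1.le h2.le hd
    rw [extendFilling_of_mem T c hc, extendFilling_of_mem T d hd]
    exact fun h3 => hT.row_marked ⟨c, hc⟩ ⟨d, hd⟩ h1 h2 (Fin.castSucc_injective n h3)
  · rw [extendFilling_of_notMem T d hd]
    intro h3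
    have hc := (extendFilling_eq_last_iff T c).1 h3
    rw [h3]
    by_contra hp
    rw [Bool.not_eq_false] at hp
    rw [hp, isStrip_true_iff_cells] at h
    refine hc (h.2 c.1.1 c.1.2 d.1.2 h2 ?_)
    rw [h1]
    exact d.2
  · have hc := hν c d h2.le h1.le hd
    rw [extendFilling_of_mem T c hc, extendFilling_of_mem T d hd]
    exact fun h3 => hT.col_marked ⟨c, hc⟩ ⟨d, hd⟩ h1 h2 (Fin.castSucc_injective n h3)
  · rw [extendFilling_of_notMem T d hd]
    intro h3
    have hc := (extendFilling_eq_last_iff T c).1 h3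
    rw [h3]
    by_contra hp
    rw [Bool.not_eq_true] at hp
    rw [hp, isStrip_false_iff_cells] at h
    refine hc (h.2 c.1.1 d.1.1 c.1.2 h2 ?_)
    rw [h1]
    exact d.2

theorem prod_extendFilling {n : ℕ} {ν μ : YoungDiagram} (h : ν ≤ μ) (x : Fin (n + 1) → A)
    (T : ν.cells → Fin n) : ∏ c : μ.cells, x (extendFilling μ T c) =
      x (Fin.last n) ^ (μ.card - ν.card) * ∏ c : ν.cells, x (T c).castSucc := by
  let g : ℕ × ℕ → A := fun c =>
    if h : c ∈ ν.cells then x (T ⟨c, h⟩).castSucc else x (Fin.last n)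
  have h1 : ∀ c : μ.cells, x (extendFilling μ T c) = g c := fun c => by
    by_cases hc : c.1 ∈ ν.cells
    · rw [extendFilling_of_mem T c hc]
      simp only [g, dif_pos hc]
    · rw [extendFilling_of_notMem T c hc]
      simp only [g, dif_neg hc]
  have h2 : ∀ c : ν.cells, x (T c).castSucc = g c := fun c => by simp only [g, dif_pos c.2]
  rw [Fintype.prod_congr _ _ h1, Fintype.prod_congr _ _ h2, Finset.prod_coe_sort μ.cells g,
    Finset.prod_coe_sort ν.cells g, ← Finset.prod_sdiff (cells_subset_iff.2 h)]
  congr 1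
  rw [Finset.prod_congr rfl (g := fun _ => x (Fin.last n))
    fun c hc => dif_neg (Finset.mem_sdiff.1 hc).2, Finset.prod_const,
    Finset.card_sdiff_of_subset (cells_subset_iff.2 h)]

theorem exists_extendFilling_eq {n : ℕ} {μ : YoungDiagram} {p : Fin (n + 1) → Bool}
    {T : μ.cells → Fin (n + 1)} (hT : IsMarkedSemistandard p T) :
    ∃ (ν : YoungDiagram) (T' : ν.cells → Fin n), IsStrip (p (Fin.last n)) ν μ ∧
      IsMarkedSemistandard (fun a => p a.castSucc) T' ∧ extendFilling μ T' = T := by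
  classical
  have hmono : ∀ c d : μ.cells, c.1 ≤ d.1 → T c ≤ T d := by
    rintro ⟨⟨i, j⟩, hc⟩ ⟨⟨i', j'⟩, hd⟩ ⟨hi : i ≤ i', hj : j ≤ j'⟩
    have he : (i, j') ∈ μ.cells := μ.isLowerSet (a := (i', j')) ⟨hi, le_rfl⟩ hd
    refine le_trans (b := T ⟨(i, j'), he⟩) ?_ ?_
    · obtain rfl | hlt := hj.eq_or_lt
      · exact le_rfl
      · exact hT.row_le _ _ rfl hlt
    · obtain rfl | hlt := hi.eq_or_lt
      · exact le_rfl
      · exact hT.col_le _ _ rfl hlt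
  let ν : YoungDiagram :=
    -- `T` is defined only on cells of `μ`, hence the quantifier over membership proofs; it imposes
    -- nothing else.
    { cells := μ.cells.filter fun c => ∀ h : c ∈ μ.cells, T ⟨c, h⟩ ≠ Fin.last n
      isLowerSet := by
        intro c d hdc hc
        simp only [Finset.coe_filter, Set.mem_ofPred_eq] at hc ⊢
        refine ⟨μ.isLowerSet hdc hc.1, fun h => ?_⟩
        exact ((hmono ⟨d, h⟩ ⟨c, hc.1⟩ hdc).trans_lt (Fin.lt_last_iff_ne_last.2 (hc.2 hc.1))).ne }
  have hν : ∀ c : μ.cells, c.1 ∈ ν.cells ↔ T c ≠ Fin.last n := fun c => by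
    simp only [ν, Finset.mem_filter]
    exact ⟨fun h => h.2 c.2, fun h => ⟨c.2, fun _ => h⟩⟩
  have hle : ν.cells ⊆ μ.cells := Finset.filter_subset _ _
  let T' : ν.cells → Fin n := fun c =>
    (T ⟨c, hle c.2⟩).castPred ((hν ⟨c, hle c.2⟩).1 c.2)
  have hT' : ∀ c : ν.cells, (T' c).castSucc = T ⟨c, hle c.2⟩ := fun c => Fin.castSucc_castPred _ _
  refine ⟨ν, T', ?_, ?_, ?_⟩
  · cases hp : p (Fin.last n)
    · refine isStrip_false_iff_cells.2 ⟨cells_subset_iff.1 hle, fun i i' j hi hc => ?_⟩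
      have hc' : (i, j) ∈ μ.cells := μ.isLowerSet (a := (i', j)) ⟨hi.le, le_rfl⟩ hc
      refine (hν ⟨(i, j), hc'⟩).2 fun h => ?_
      have h2 := hT.col_le ⟨(i, j), hc'⟩ ⟨(i', j), hc⟩ rfl hi
      rw [h, Fin.last_le_iff] at h2
      have h3 := hT.col_marked ⟨(i, j), hc'⟩ ⟨(i', j), hc⟩ rfl hi (h.trans h2.symm)
      rw [h, hp] at h3
      exact Bool.false_ne_true h3
    · refine isStrip_true_iff_cells.2 ⟨cells_subset_iff.1 hle, fun i j j' hj hc => ?_⟩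
      have hc' : (i, j) ∈ μ.cells := μ.isLowerSet (a := (i, j')) ⟨le_rfl, hj.le⟩ hc
      refine (hν ⟨(i, j), hc'⟩).2 fun h => ?_
      have h2 := hT.row_le ⟨(i, j), hc'⟩ ⟨(i, j'), hc⟩ rfl hj
      rw [h, Fin.last_le_iff] at h2
      have h3 := hT.row_marked ⟨(i, j), hc'⟩ ⟨(i, j'), hc⟩ rfl hj (h.trans h2.symm)
      rw [h, hp] at h3
      exact Bool.false_ne_true h3.symm
  · refine ⟨fun c d h1 h2 => ?_, fun c d h1 h2 => ?_, fun c d h1 h2 h3 => ?_,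
      fun c d h1 h2 h3 => ?_⟩
    · exact hT.row_le ⟨c, hle c.2⟩ ⟨d, hle d.2⟩ h1 h2
    · exact hT.col_le ⟨c, hle c.2⟩ ⟨d, hle d.2⟩ h1 h2
    · have := congrArg Fin.castSucc h3
      rw [hT', hT'] at this
      simpa only [hT'] using hT.row_marked ⟨c, hle c.2⟩ ⟨d, hle d.2⟩ h1 h2 this
    · have := congrArg Fin.castSucc h3
      rw [hT', hT'] at this
      simpa only [hT'] using hT.col_marked ⟨c, hle c.2⟩ ⟨d, hle d.2⟩ h1 h2 this
  · funext c
    by_cases hc : c.1 ∈ ν.cells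
    · rw [extendFilling_of_mem T' c hc, hT']
    · rw [extendFilling_of_notMem T' c hc]
      exact (not_not.1 (mt (hν c).2 hc)).symm

/-- The cells not carrying the last letter form a diagram `ν`, and the no-repetition rule for that
letter says exactly that `μ / ν` is a strip of the matching kind. -/
theorem markedSchur_succ {n : ℕ} (p : Fin (n + 1) → Bool) (x : Fin (n + 1) → A)
    (μ : YoungDiagram) : markedSchur p x μ = ∑ ν ∈ strips (p (Fin.last n)) μ,
      x (Fin.last n) ^ (μ.card - ν.card) *
        markedSchur (fun a : Fin n => p a.castSucc) (fun a : Fin n => x a.castSucc) ν := by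
  classical
  unfold markedSchur
  simp only [Finset.mul_sum]
  rw [Finset.sum_sigma']
  symm
  refine Finset.sum_bij (fun a _ => extendFilling μ a.2) ?_ ?_ ?_ ?_
  · rintro ⟨ν, T⟩ h
    simp only [Finset.mem_sigma, mem_strips, Finset.mem_filter, Finset.mem_univ, true_and] at h ⊢
    exact isMarkedSemistandard_extendFilling h.2 h.1
  · rintro ⟨ν, T⟩ h ⟨ν', T'⟩ h' heq
    simp only [Finset.mem_sigma, mem_strips, Finset.mem_filter, Finset.mem_univ, true_and] at h h'
    simp only at heq
    have hle := cells_subset_iff.2 h.1.le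
    have hle' := cells_subset_iff.2 h'.1.le
    have hmem : ∀ c : μ.cells, c.1 ∈ ν.cells ↔ c.1 ∈ ν'.cells := fun c => by
      rw [← not_iff_not, ← extendFilling_eq_last_iff T c, ← extendFilling_eq_last_iff T' c, heq]
    obtain rfl : ν = ν' := by
      ext c
      exact ⟨fun hc => (hmem ⟨c, hle hc⟩).1 hc, fun hc => (hmem ⟨c, hle' hc⟩).2 hc⟩
    congr 1
    funext c
    have := congrFun heq ⟨c.1, hle c.2⟩
    rw [extendFilling_of_mem T ⟨c.1, hle c.2⟩ c.2, extendFilling_of_mem T' ⟨c.1, hle c.2⟩ c.2] at this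
    exact Fin.castSucc_injective n this
  · intro T hT
    obtain ⟨ν, T', h1, h2, h3⟩ := exists_extendFilling_eq (Finset.mem_filter.1 hT).2
    refine ⟨⟨ν, T'⟩, ?_, h3⟩
    simp only [Finset.mem_sigma, mem_strips, Finset.mem_filter, Finset.mem_univ, true_and]
    exact ⟨h1, h2⟩
  · rintro ⟨ν, T⟩ h
    simp only [Finset.mem_sigma, mem_strips] at h
    exact (prod_extendFilling h.1.le x T).symm

theorem markedSchur_fin_zero (p : Fin 0 → Bool) (x : Fin 0 → A) (μ : YoungDiagram) :
    markedSchur p x μ = Finsupp.single μ 1 ⊥ := by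
  classical
  unfold markedSchur
  by_cases hμ : μ = ⊥
  · subst hμ
    have : IsEmpty (⊥ : YoungDiagram).cells := ⟨fun c => notMem_bot _ c.2⟩
    rw [Finset.filter_true_of_mem]
    · simp
    · exact fun T _ => ⟨fun c => isEmptyElim c, fun c => isEmptyElim c, fun c => isEmptyElim c,
        fun c => isEmptyElim c⟩
  · rw [Finsupp.single_eq_of_ne' hμ]
    obtain ⟨c, hc⟩ : μ.cells.Nonempty := by
      rw [Finset.nonempty_iff_ne_empty]
      exact fun h => hμ (YoungDiagram.ext h)
    exact Finset.sum_eq_zero fun T _ => (T ⟨c, hc⟩).elim0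

theorem markedSchur_eq_prod_stripOp {n : ℕ} (p : Fin n → Bool) (x : Fin n → A)
    (μ : YoungDiagram) : markedSchur p x μ =
      (List.ofFn fun i => stripOp (p i) (x i)).prod (Finsupp.single μ 1) ⊥ := by
  induction n generalizing μ with
  | zero => simp [markedSchur_fin_zero]
  | succ n ih =>
    rw [markedSchur_succ, List.ofFn_succ_last, List.prod_append, Module.End.mul_apply,
      List.prod_singleton, stripOp_single, map_sum, Finsupp.finsetSum_apply]
    refine Finset.sum_congr rfl fun ν _ => ?_
    rw [ih, ← smul_eq_mul, ← Finsupp.smul_apply, ← map_smul, Finsupp.smul_single, smul_eq_mul,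
      mul_one]

theorem schur_eq_prod_stripOp (μ : YoungDiagram) {n : ℕ} (x : Fin n → A) :
    schur μ x = (List.ofFn fun i => stripOp false (x i)).prod (Finsupp.single μ 1) ⊥ := by
  rw [schur_eq_markedSchur, markedSchur_eq_prod_stripOp]

theorem hookSchur_eq_prod_stripOp (μ : YoungDiagram) {k l : ℕ} (x : Fin k → A) (y : Fin l → A) :
    hookSchur μ x y = ((List.ofFn fun i => stripOp false (x i)).prod *
      (List.ofFn fun j => stripOp true (y j)).prod) (Finsupp.single μ 1) ⊥ := by
  rw [hookSchur_eq_markedSchur]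
  have h := markedSchur_orderIso (finSumLexIso k l)
    (Fin.append (fun _ => false) (fun _ => true)) (Fin.append x y) μ
  have e1 : (fun a => Fin.append (fun _ : Fin k => false) (fun _ : Fin l => true)
      (finSumLexIso k l a)) = fun a => Sum.elim (fun _ => false) (fun _ => true) (ofLex a) := by
    funext a
    induction a using Lex.rec with | _ a
    rcases a with a | a <;> simp [finSumLexIso]
  have e2 : (fun a => Fin.append x y (finSumLexIso k l a)) = fun a => Sum.elim x y (ofLex a) := by
    funext a
    induction a using Lex.rec with | _ a
    rcases a with a | a <;> simp [finSumLexIso]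
  rw [e1, e2] at h
  rw [h, markedSchur_eq_prod_stripOp, ← List.prod_append, ← List.ofFn_fin_append]
  congr 4
  funext i
  refine Fin.addCases (fun i => ?_) (fun i => ?_) i <;> simp

end Tableau

/-! ### Removing the first row: the largest horizontal strip. -/

namespace YoungDiagram

/-- The Young diagram obtained by removing the first row. -/
def removeFirstRow (μ : YoungDiagram) : YoungDiagram :=
  μ.truncate fun i => μ.rowLen (i + 1)

theorem rowLen_removeFirstRow (μ : YoungDiagram) (i : ℕ) :
    μ.removeFirstRow.rowLen i = μ.rowLen (i + 1) :=
  rowLen_truncate (f := fun i => μ.rowLen (i + 1))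
    (fun _ _ h => μ.rowLen_anti _ _ (Nat.add_le_add_right h 1))
    (fun i => μ.rowLen_anti _ _ (Nat.le_add_right i 1)) i

theorem isStrip_removeFirstRow (μ : YoungDiagram) : IsStrip false μ.removeFirstRow μ :=
  isStrip_false_iff.2 ⟨fun i => by
    rw [rowLen_removeFirstRow]
    exact μ.rowLen_anti _ _ (Nat.le_add_right i 1), fun i => (rowLen_removeFirstRow μ i).ge⟩

theorem IsStrip.removeFirstRow_le {μ ν : YoungDiagram} (h : IsStrip false ν μ) :
    μ.removeFirstRow ≤ ν :=
  le_iff_rowLen.2 fun i => by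
    rw [rowLen_removeFirstRow]
    exact (isStrip_false_iff.1 h).2 i

theorem card_removeFirstRow (μ : YoungDiagram) :
    μ.card = μ.removeFirstRow.card + μ.rowLen 0 := by
  have h : μ.rowLen (μ.colLen 0 + 1) = 0 := rowLen_eq_zero_of_colLen_le (Nat.le_succ _)
  rw [card_eq_sum_rowLen h, Finset.sum_range_succ',
    card_eq_sum_rowLen ((rowLen_removeFirstRow μ _).trans h)]
  simp only [rowLen_removeFirstRow]

theorem eq_of_removeFirstRow_eq {μ ν : YoungDiagram} (h : μ.removeFirstRow = ν.removeFirstRow)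
    (h0 : μ.rowLen 0 = ν.rowLen 0) : μ = ν := by
  refine ext_rowLen fun i => ?_
  cases i with
  | zero => exact h0
  | succ i => rw [← rowLen_removeFirstRow, ← rowLen_removeFirstRow, h]

theorem eq_bot_of_rowLen_zero {μ : YoungDiagram} (h : μ.rowLen 0 = 0) : μ = ⊥ := by
  refine le_bot_iff.1 fun c hc => ?_
  have h1 := mem_iff_lt_rowLen.1 (show (c.1, c.2) ∈ μ from hc)
  have h2 := μ.rowLen_anti 0 c.1 (Nat.zero_le _)
  omega

end YoungDiagram

/-! ### Changing the coefficients. -/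

section BaseChange

variable {A B : Type*} [CommRing A] [CommRing B]

/-- `φ` is only additive so that extracting a coefficient of a polynomial is covered as well as ring
homomorphisms. -/
theorem mapRange_stripOp (φ : A →+ B) (p : Bool) {t : A} {t' : B}
    (h : ∀ a k, φ (a * t ^ k) = φ a * t' ^ k) (F : YoungDiagram →₀ A) :
    Finsupp.mapRange.addMonoidHom φ (stripOp p t F) =
      stripOp p t' (Finsupp.mapRange.addMonoidHom φ F) := by
  induction F using Finsupp.induction_linear with
  | zero => simp
  | add F G hF hG => simp only [map_add, hF, hG]
  | single μ a =>
    rw [stripOp_single', map_sum]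
    simp only [Finsupp.mapRange.addMonoidHom_apply, Finsupp.mapRange_single, h, stripOp_single']

theorem mapRange_prod_stripOp (φ : A →+ B) {N : ℕ} {x : Fin N → A} {x' : Fin N → B}
    (h : ∀ i a k, φ (a * x i ^ k) = φ a * x' i ^ k) (F : YoungDiagram →₀ A) :
    Finsupp.mapRange.addMonoidHom φ ((List.ofFn fun i => stripOp false (x i)).prod F) =
      (List.ofFn fun i => stripOp false (x' i)).prod (Finsupp.mapRange.addMonoidHom φ F) := by
  induction N with
  | zero => simp
  | succ N ih =>
    rw [List.ofFn_succ, List.ofFn_succ, List.prod_cons, List.prod_cons, Module.End.mul_apply,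
      Module.End.mul_apply, mapRange_stripOp φ false (h 0), ih fun i => h i.succ]

open scoped Classical in
theorem stripOp_apply (p : Bool) (t : A) (F : YoungDiagram →₀ A) (ν : YoungDiagram) :
    stripOp p t F ν =
      F.sum fun μ a => if IsStrip p ν μ then a * t ^ (μ.card - ν.card) else 0 := by
  rw [stripOp, Finsupp.linearCombination_apply, Finsupp.sum, Finsupp.finsetSum_apply]
  refine Finset.sum_congr rfl fun μ _ => ?_
  simp only [Finsupp.smul_apply, Finsupp.finsetSum_apply, Finsupp.single_apply,
    Finset.sum_ite_eq', mem_strips, smul_eq_mul, mul_ite, mul_zero]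

end BaseChange

/-! ### Linear independence of the Schur functions. -/

section Independence

open Polynomial

universe u

variable {A : Type u} [CommRing A]

/-- The combination `G` of Young diagrams pairs to zero with all Schur polynomials over all
extensions of the coefficient ring. -/
def SchurVanishes (G : YoungDiagram →₀ A) : Prop :=
  ∀ (C : Type u) [CommRing C] (f : A →+* C) (N : ℕ) (x : Fin N → C),
    (List.ofFn fun i => stripOp false (x i)).prod
      (Finsupp.mapRange.addMonoidHom f.toAddMonoidHom G) ⊥ = 0

/-- Remove horizontal strips with exactly `d` cells. -/
noncomputable def removeHorizontal (d : ℕ) (G : YoungDiagram →₀ A) : YoungDiagram →₀ A :=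
  Finsupp.mapRange.addMonoidHom (lcoeff A d).toAddMonoidHom
    (stripOp false X (Finsupp.mapRange.addMonoidHom (C : A →+* A[X]).toAddMonoidHom G))

open scoped Classical in
theorem removeHorizontal_apply (d : ℕ) (G : YoungDiagram →₀ A) (ν : YoungDiagram) :
    removeHorizontal d G ν =
      G.sum fun μ a => if IsStrip false ν μ ∧ μ.card - ν.card = d then a else 0 := by
  rw [removeHorizontal, Finsupp.mapRange.addMonoidHom_apply, Finsupp.mapRange_apply,
    stripOp_apply, Finsupp.mapRange.addMonoidHom_apply, Finsupp.sum_mapRange_index (by simp)]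
  refine (map_sum (lcoeff A d) _ _).trans ?_
  refine Finset.sum_congr rfl fun μ _ => ?_
  change coeff (ite _ (C (G μ) * X ^ _) _) d = _
  by_cases h : IsStrip false ν μ
  · simp only [h, if_true, true_and, coeff_C_mul_X_pow, eq_comm]
  · simp [h]

/-- Adjoin a polynomial variable `X` as one more Schur variable and read off the coefficient of `X ^
d`. This is why `SchurVanishes` ranges over all extensions of the coefficients. -/
theorem SchurVanishes.removeHorizontal {G : YoungDiagram →₀ A} (hG : SchurVanishes G) (d : ℕ) :
    SchurVanishes (removeHorizontal d G) := by
  intro B _ f N x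
  have h := hG B[X] (C.comp f) (N + 1) (Fin.snoc (fun i => C (x i)) X)
  have e1 : Finsupp.mapRange.addMonoidHom (C.comp f).toAddMonoidHom G =
      Finsupp.mapRange.addMonoidHom (mapRingHom f).toAddMonoidHom
        (Finsupp.mapRange.addMonoidHom (C : A →+* A[X]).toAddMonoidHom G) := by
    ext ν : 1
    simp
  have e2 := mapRange_stripOp (mapRingHom f).toAddMonoidHom false (t := X) (t' := X)
    (fun a k => by simp) (Finsupp.mapRange.addMonoidHom (C : A →+* A[X]).toAddMonoidHom G)
  have e3 := mapRange_prod_stripOp (lcoeff B d).toAddMonoidHom (x := fun i => C (x i)) (x' := x)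
    (fun i a k => by
      change coeff (a * C (x i) ^ k) d = coeff a d * _
      rw [← C_pow, coeff_mul_C])
    (stripOp false X (Finsupp.mapRange.addMonoidHom (C.comp f).toAddMonoidHom G))
  have e4 : Finsupp.mapRange.addMonoidHom (lcoeff B d).toAddMonoidHom
      (stripOp false X (Finsupp.mapRange.addMonoidHom (C.comp f).toAddMonoidHom G)) =
      Finsupp.mapRange.addMonoidHom f.toAddMonoidHom (_root_.removeHorizontal d G) := by
    rw [e1, ← e2, _root_.removeHorizontal]
    ext ν : 1
    simp
  rw [List.ofFn_succ_last, List.prod_append, List.prod_singleton, Module.End.mul_apply] at h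
  simp only [Fin.snoc_castSucc, Fin.snoc_last] at h
  rw [← e4, ← e3, Finsupp.mapRange.addMonoidHom_apply, Finsupp.mapRange_apply, h, map_zero]

/-- If a strip of `μ.rowLen 0` cells leads from `ν` to `μ.removeFirstRow`, then `ν.removeFirstRow`
lies inside the latter. As `ν.rowLen 0 ≤ μ.rowLen 0`, counting cells forces equality, so `ν = μ` and
no other term contributes. -/
theorem removeHorizontal_removeFirstRow {G : YoungDiagram →₀ A} {μ : YoungDiagram}
    (h : ∀ ν ∈ G.support, ν.rowLen 0 ≤ μ.rowLen 0) :
    removeHorizontal (μ.rowLen 0) G μ.removeFirstRow = G μ := by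
  classical
  have hμ := card_removeFirstRow μ
  rw [removeHorizontal_apply, Finsupp.sum, Finset.sum_eq_single μ]
  · rw [if_pos ⟨isStrip_removeFirstRow μ, by omega⟩]
  · intro ν hν hne
    refine if_neg fun ⟨h1, h2⟩ => hne ?_
    have e1 := h ν hν
    have e2 := card_removeFirstRow ν
    have e3 := h1.card_le
    have e4 := card_le_card_of_le h1.removeFirstRow_le
    exact eq_of_removeFirstRow_eq (eq_of_le_of_card_le h1.removeFirstRow_le (by omega))
      (by omega)
  · intro h0
    simp [Finsupp.notMem_support_iff.1 h0]

theorem SchurVanishes.eq_zero {G : YoungDiagram →₀ A} (hG : SchurVanishes G) : G = 0 := by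
  classical
  obtain ⟨n, hn⟩ : ∃ n, ∀ μ ∈ G.support, μ.card < n :=
    ⟨G.support.sup YoungDiagram.card + 1, fun μ h => Nat.lt_succ_of_le (Finset.le_sup h)⟩
  induction n generalizing G with
  | zero =>
    exact Finsupp.support_eq_empty.1 (Finset.eq_empty_of_forall_notMem fun μ h =>
      Nat.not_lt_zero _ (hn μ h))
  | succ n ih =>
    by_contra hne
    obtain ⟨μ, hμ, hmax⟩ := G.support.exists_max_image (fun μ => μ.rowLen 0)
      (Finsupp.support_nonempty_iff.2 hne)
    refine Finsupp.mem_support_iff.1 hμ ?_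
    by_cases h0 : μ.rowLen 0 = 0
    -- With no variables, the pairing is just the coefficient of `⊥`.
    · have h := hG A (RingHom.id A) 0 Fin.elim0
      rw [eq_bot_of_rowLen_zero h0]
      simpa using h
    -- A nonempty strip is removed, so the bound on the sizes in the support drops.
    · rw [← removeHorizontal_removeFirstRow hmax, ih (hG.removeHorizontal _) fun ν hν => ?_,
        Finsupp.zero_apply]
      rw [Finsupp.mem_support_iff, removeHorizontal_apply] at hν
      obtain ⟨κ, hκ, hκ'⟩ := Finset.exists_ne_zero_of_sum_ne_zero hν
      have h1 := (ite_ne_right_iff.1 hκ').1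
      have h2 := hn κ hκ
      omega

end Independence

/-! ### Values of combinations, and specialisation of variables. -/

section Sums

variable {R A : Type*} [CommRing R] [CommRing A] [Algebra R A]

theorem sum_smul_apply_bot (m : YoungDiagram →₀ R) (Φ : Module.End A (YoungDiagram →₀ A)) :
    (m.sum fun μ r => r • Φ (Finsupp.single μ 1) ⊥) =
      Φ (Finsupp.mapRange.addMonoidHom (algebraMap R A).toAddMonoidHom m) ⊥ := by
  induction m using Finsupp.induction_linear with
  | zero => simp
  | add F G hF hG =>
    rw [Finsupp.sum_add_index' (by simp) (by simp [add_smul]), hF, hG, map_add, map_add,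
      Finsupp.add_apply]
  | single μ a =>
    rw [Finsupp.sum_single_index (by simp), Finsupp.mapRange.addMonoidHom_apply,
      Finsupp.mapRange_single]
    change _ = Φ (Finsupp.single μ (algebraMap R A a)) ⊥
    rw [← mul_one (algebraMap R A a), ← smul_eq_mul, ← Finsupp.smul_single, map_smul,
      Finsupp.smul_apply, smul_eq_mul, Algebra.smul_def]

theorem schurSum_eq_prod_stripOp (m : YoungDiagram →₀ R) {n : ℕ} (x : Fin n → A) :
    schurSum m x = (List.ofFn fun i => stripOp false (x i)).prod
      (Finsupp.mapRange.addMonoidHom (algebraMap R A).toAddMonoidHom m) ⊥ := by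
  rw [← sum_smul_apply_bot]
  simp only [schurSum, schur_eq_prod_stripOp]

theorem hookSchurSum_eq_prod_stripOp (m : YoungDiagram →₀ R) {k l : ℕ} (x : Fin k → A)
    (y : Fin l → A) :
    hookSchurSum m x y = ((List.ofFn fun i => stripOp false (x i)).prod *
      (List.ofFn fun j => stripOp true (y j)).prod)
      (Finsupp.mapRange.addMonoidHom (algebraMap R A).toAddMonoidHom m) ⊥ := by
  rw [← sum_smul_apply_bot]
  simp only [hookSchurSum, hookSchur_eq_prod_stripOp]

variable {B : Type*} [CommRing B] [Algebra R B]

theorem map_schurSum (φ : A →ₐ[R] B) (m : YoungDiagram →₀ R) {n : ℕ} (x : Fin n → A) :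
    φ (schurSum m x) = schurSum m fun i => φ (x i) := by
  simp only [schurSum, schur, map_finsuppSum, map_smul, map_sum, map_prod]

theorem map_hookSchurSum (φ : A →ₐ[R] B) (m : YoungDiagram →₀ R) {k l : ℕ} (x : Fin k → A)
    (y : Fin l → A) :
    φ (hookSchurSum m x y) = hookSchurSum m (fun i => φ (x i)) fun j => φ (y j) := by
  have h : ∀ a : Fin k ⊕ Fin l, φ (Sum.elim x y a) =
      Sum.elim (fun i => φ (x i)) (fun j => φ (y j)) a := by
    rintro (a | a) <;> rfl
  simp only [hookSchurSum, hookSchur, map_finsuppSum, map_smul, map_sum, map_prod, h]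

end Sums

/-! ### From the hypothesis to double symmetry. -/

section Main

universe u

theorem List.prod_ofFn_of_eq_one {M : Type*} [Monoid M] {n : ℕ} (hn : n = 1) (g : Fin n → M) :
    (List.ofFn g).prod = g ⟨0, by omega⟩ := by
  subst hn
  simp

/-- The hypothesis that `∑ m_λ S_λ` is a combination of hook Schur functions in any number of
variables, for any splitting of the variables. -/
def IsHookCombination {R : Type*} [CommRing R] (m : YoungDiagram →₀ R) : Prop :=
  ∀ (n i : ℕ) (hi : i ≤ n), ∃ c : YoungDiagram →₀ R,
    schurSum m (fun a : Fin n => (MvPolynomial.X a : MvPolynomial (Fin n) R)) =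
      hookSchurSum c
        (fun a : Fin i => (MvPolynomial.X (Fin.castLE hi a) : MvPolynomial (Fin n) R))
        (fun b : Fin (n - i) =>
          (MvPolynomial.X ⟨i + b.1, Nat.add_lt_of_lt_sub' b.2⟩ : MvPolynomial (Fin n) R))

variable {R : Type u} [CommRing R] {m : YoungDiagram →₀ R}

theorem commute_prod_stripOp {A : Type*} [CommRing A] (p q : Bool) (t : A) {n : ℕ} (x : Fin n → A) :
    Commute (stripOp p t) (List.ofFn fun i => stripOp q (x i)).prod := by
  refine Commute.list_prod_right _ _ fun f hf => ?_
  obtain ⟨i, rfl⟩ := (List.mem_ofFn' _ _).1 hf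
  exact commute_stripOp p q t (x i)

/-- The coefficients `c` are chosen for generic variables, before `s` is substituted. After
specialising to `s, x, -s` the hook side loses all trace of `s`, so one value `a` serves for every
`s`. -/
theorem IsHookCombination.exists_forall_eq {C : Type*} [CommRing C] [Algebra R C]
    (h : IsHookCombination m) {N : ℕ} (x : Fin N → C) :
    ∃ a : C, ∀ s : C, (List.ofFn fun i => stripOp false (x i)).prod
      (stripOp false s (stripOp false (-s)
        (Finsupp.mapRange.addMonoidHom (algebraMap R C).toAddMonoidHom m))) ⊥ = a := by
  obtain ⟨c, hc⟩ := h (N + 2) (N + 1) (Nat.le_succ _)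
  set P := (List.ofFn fun i => stripOp false (x i)).prod with hP
  refine ⟨P (Finsupp.mapRange.addMonoidHom (algebraMap R C).toAddMonoidHom c) ⊥, fun s => ?_⟩
  let w : Fin (N + 2) → C := Fin.snoc (Fin.cons s x : Fin (N + 1) → C) (-s)
  have hPs : (List.ofFn fun a : Fin (N + 1) => stripOp false (w a.castSucc)).prod =
      stripOp false s * P := by
    simp only [w, Fin.snoc_castSucc]
    rw [List.ofFn_succ, List.prod_cons]
    simp only [Fin.cons_zero, Fin.cons_succ, hP]
  have hcomm : Commute (stripOp false s) P := commute_prod_stripOp _ _ _ _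
  have hw := congrArg (MvPolynomial.aeval w) hc
  rw [map_schurSum, map_hookSchurSum, schurSum_eq_prod_stripOp, hookSchurSum_eq_prod_stripOp,
    List.prod_ofFn_of_eq_one (show N + 2 - (N + 1) = 1 by omega), List.ofFn_succ_last, List.prod_append,
    List.prod_singleton] at hw
  simp only [MvPolynomial.aeval_X] at hw
  -- The indices `Fin.castLE _ a` and `⟨N + 1 + 0, _⟩` of the hypothesis are `a.castSucc` and
  -- `Fin.last (N + 1)` by definition.
  change ((List.ofFn fun a : Fin (N + 1) => stripOp false (w a.castSucc)).prod *
      stripOp false (w (Fin.last (N + 1)))) _ _ =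
    ((List.ofFn fun a : Fin (N + 1) => stripOp false (w a.castSucc)).prod *
      stripOp true (w (Fin.last (N + 1)))) _ _ at hw
  rw [hPs, show w (Fin.last (N + 1)) = -s from Fin.snoc_last _ _, hcomm.eq, mul_assoc, mul_assoc,
    stripOp_false_mul_true, mul_one] at hw
  exact hw

theorem IsHookCombination.stripOp_neg_eq {A : Type u} [CommRing A] [Algebra R A]
    (h : IsHookCombination m) (t : A) :
    stripOp false t (stripOp false (-t)
        (Finsupp.mapRange.addMonoidHom (algebraMap R A).toAddMonoidHom m)) =
      Finsupp.mapRange.addMonoidHom (algebraMap R A).toAddMonoidHom m := by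
  refine sub_eq_zero.1 (SchurVanishes.eq_zero fun C _ f N x => ?_)
  let : Algebra R C := (f.comp (algebraMap R A)).toAlgebra
  have e1 : Finsupp.mapRange.addMonoidHom f.toAddMonoidHom
      (Finsupp.mapRange.addMonoidHom (algebraMap R A).toAddMonoidHom m) =
      Finsupp.mapRange.addMonoidHom (algebraMap R C).toAddMonoidHom m := by
    ext ν : 1
    simp [RingHom.algebraMap_toAlgebra]
  have hf : ∀ t a k, f.toAddMonoidHom (a * t ^ k) = f.toAddMonoidHom a * f t ^ k :=
    fun t a k => by simp
  obtain ⟨a, ha⟩ := h.exists_forall_eq x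
  -- At `s = 0` both extra operators are the identity, which identifies the constant.
  have h0 := ha 0
  rw [neg_zero, stripOp_zero, Module.End.one_apply, Module.End.one_apply] at h0
  rw [map_sub, map_sub, Finsupp.sub_apply, mapRange_stripOp _ _ (hf t),
    mapRange_stripOp _ _ (hf (-t)), e1, map_neg, ha, h0, sub_self]

/-- Apply `stripOp true t`, the inverse of `stripOp false (-t)`, to the previous identity. -/
theorem IsHookCombination.stripOp_true_eq {A : Type u} [CommRing A] [Algebra R A]
    (h : IsHookCombination m) (t : A) :
    stripOp true t (Finsupp.mapRange.addMonoidHom (algebraMap R A).toAddMonoidHom m) =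
      stripOp false t (Finsupp.mapRange.addMonoidHom (algebraMap R A).toAddMonoidHom m) := by
  have h1 := stripOp_true_mul_false (-t)
  rw [neg_neg] at h1
  conv_lhs => rw [← h.stripOp_neg_eq t]
  rw [← Module.End.mul_apply (stripOp false t), (commute_stripOp_false t (-t)).eq,
    Module.End.mul_apply, ← Module.End.mul_apply (stripOp true t), h1, Module.End.one_apply]

/-- The variables are converted one at a time; commutativity brings each remaining vertical operator
next to `m`. -/
theorem IsHookCombination.prod_stripOp_true_eq {A : Type u} [CommRing A] [Algebra R A]
    (h : IsHookCombination m) {n : ℕ} (y : Fin n → A) :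
    (List.ofFn fun i => stripOp true (y i)).prod
        (Finsupp.mapRange.addMonoidHom (algebraMap R A).toAddMonoidHom m) =
      (List.ofFn fun i => stripOp false (y i)).prod
        (Finsupp.mapRange.addMonoidHom (algebraMap R A).toAddMonoidHom m) := by
  induction n with
  | zero => simp
  | succ n ih =>
    rw [List.ofFn_succ, List.ofFn_succ, List.prod_cons, List.prod_cons, Module.End.mul_apply, ih,
      ← Module.End.mul_apply, (commute_prod_stripOp _ _ _ _).eq, Module.End.mul_apply,
      h.stripOp_true_eq, ← Module.End.mul_apply, (commute_prod_stripOp _ _ _ _).eq]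

theorem IsHookCombination.isDoublySymmetric (h : IsHookCombination m) : IsDoublySymmetric m := by
  intro k l x y
  have e : (fun i => stripOp false (Fin.append x y i)) =
      Fin.append (fun i => stripOp false (x i)) (fun j => stripOp false (y j)) := by
    funext i
    refine Fin.addCases (fun i => ?_) (fun i => ?_) i <;> simp
  rw [schurSum_eq_prod_stripOp, hookSchurSum_eq_prod_stripOp, e, List.ofFn_fin_append,
    List.prod_append, Module.End.mul_apply, Module.End.mul_apply, h.prod_stripOp_true_eq]

end Main

theorem theorem3p12 {R : Type*} [CommRing R] [IsDomain R] [CharZero R]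
    (m : YoungDiagram →₀ R)
    (h : ∀ (n i : ℕ) (hi : i ≤ n), ∃ c : YoungDiagram →₀ R,
      schurSum m (fun a : Fin n => (MvPolynomial.X a : MvPolynomial (Fin n) R)) =
        hookSchurSum c
          (fun a : Fin i => (MvPolynomial.X (Fin.castLE hi a) : MvPolynomial (Fin n) R))
          (fun b : Fin (n - i) =>
            (MvPolynomial.X ⟨i + b.1, Nat.add_lt_of_lt_sub' b.2⟩ : MvPolynomial (Fin n) R))) :
    IsDoublySymmetric m :=
  IsHookCombination.isDoublySymmetric h
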